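/- Let $\mathbb{N}_0=\{0,1,2,\dots\}$. A vector $m=m^{(n)}=(m_1,\dots,m_n)\in\mathbb{R}^n$ is \emph{realizable} (on $\mathbb{N}_0$) if there is a probability measure $\mu$ on $\mathbb{N}_0$ with finite moments up to order $n$ and $E_\mu[X^k]=m_k$ for $k=1,\dots,n$; put $m_0=1$ and $m^{(n-1)}=(m_1,\dots,m_{n-1})$. Let $\mathcal{P}_n$ be the set of monic real polynomials of degree $n$ that have $n$ distinct roots in $\mathbb{N}_0$ and are nonnegative on $\mathbb{N}_0$. For $P(x)=\sum_{k=0}^n p_kx^k$ let $L_P(m)=\sum_{k=0}^n p_km_k$. A realizable vector $m^{(n)}$ is \emph{I-realizable} if $L_P(m)>0$ for all $P\in\mathcal{P}_n\cup\mathcal{P}_{n-1}$, and \emph{B-realizable} if $L_P(m)=0$ for some $P\in\mathcal{P}_n\cup\mathcal{P}_{n-1}$. A \emph{minimizing polynomial} for $m^{(n)}$ is a $P_n^{(m)}\in\mathcal{P}_n$ with $L_{P_n^{(m)}}(m)\le L_P(m)$ for all $P\in\mathcal{P}_n$. \textbf{Theorem.} Let $n\ge 1$ and $m=m^{(n)}=(m_1,\dots,m_n)\in\mathbb{R}^n$.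 If $m$ is realizable, then it is either I-realizable or B-realizable, but not both. Moreover: (a) If $n=1$, then $m=(m_1)$ is I-realizable if $m_1>0$, B-realizable if $m_1=0$, and not realizable if $m_1<0$. (b) If $n\ge2$ and $m^{(n-1)}$ is not realizable, then $m^{(n)}$ is not realizable. (c) If $n\ge2$ and $m^{(n-1)}$ is I-realizable, then a minimizing polynomial for $m^{(n)}$ exists, and for every minimizing polynomial $P_n^{(m)}$, $m^{(n)}$ is realizable if and only if $L_{P_n^{(m)}}(m)\ge0$; moreover $m^{(n)}$ is I-realizable if $L_{P_n^{(m)}}(m)>0$ and B-realizable if $L_{P_n^{(m)}}(m)=0$. (d) If $n\ge2$ and $m^{(n-1)}$ is B-realizable, then $L_P(m)=0$ for some $i\in\{1,2\}$ and some $P\in\mathcal{P}_{n-i}$; and for every such $i$ and $P$, $m^{(n)}$ is realizable if and only if $L_{x^iP}(m)=0$, and $m^{(n)}$ is B-realizable if and only if $L_{x^iP}(m)=0$. -/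

import Mathlib

open MeasureTheory Polynomial

noncomputable section

/-- The vector `m = (m_1, …, m_n)` (with `m_{k+1}` stored as `m k`) is realizable on `ℕ₀`: there is
a probability measure on `ℕ` whose moments of order `1, …, n` exist and equal `m_1, …, m_n`. -/
def Realizable {n : ℕ} (m : Fin n → ℝ) : Prop :=
  ∃ μ : Measure ℕ, IsProbabilityMeasure μ ∧
    ∀ k : Fin n, Integrable (fun x : ℕ => (x : ℝ) ^ ((k : ℕ) + 1)) μ ∧
      ∫ x : ℕ, (x : ℝ) ^ ((k : ℕ) + 1) ∂μ = m k

/-- `m^{(n-1)} = (m_1, …, m_{n-1})`. -/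
def dropLast {n : ℕ} (m : Fin n → ℝ) : Fin (n - 1) → ℝ :=
  fun k => m (Fin.castLE (Nat.sub_le n 1) k)

/-- `𝒫_n`: the monic polynomials of degree `n` with `n` distinct roots in `ℕ₀` that are
nonnegative on `ℕ₀`. -/
def monicNonneg (n : ℕ) : Set ℝ[X] :=
  {P | P.Monic ∧ P.natDegree = n ∧ {k : ℕ | P.eval (k : ℝ) = 0}.ncard = n ∧
    ∀ k : ℕ, 0 ≤ P.eval (k : ℝ)}

/-- `L_P(m) = ∑_{k=0}^n p_k m_k` with `m_0 = 1`, for a polynomial `P = ∑ p_k x^k` of degree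
at most `n`. -/
def momentForm {n : ℕ} (P : ℝ[X]) (m : Fin n → ℝ) : ℝ :=
  ∑ k : Fin (n + 1), P.coeff (k : ℕ) * (Fin.cons 1 m : Fin (n + 1) → ℝ) k

/-- `m` is I-realizable: realizable with `L_P(m) > 0` for all `P ∈ 𝒫_n ∪ 𝒫_{n-1}`. -/
def IRealizable {n : ℕ} (m : Fin n → ℝ) : Prop :=
  Realizable m ∧ ∀ P ∈ monicNonneg n ∪ monicNonneg (n - 1), 0 < momentForm P m

/-- `m` is B-realizable: realizable with `L_P(m) = 0` for some `P ∈ 𝒫_n ∪ 𝒫_{n-1}`. -/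
def BRealizable {n : ℕ} (m : Fin n → ℝ) : Prop :=
  Realizable m ∧ ∃ P ∈ monicNonneg n ∪ monicNonneg (n - 1), momentForm P m = 0

/-- `P` is a minimizing polynomial `P_n^{(m)}`: it lies in `𝒫_n` and minimizes `L_Q(m)` over
`Q ∈ 𝒫_n`. -/
def IsMinimizing {n : ℕ} (P : ℝ[X]) (m : Fin n → ℝ) : Prop :=
  P ∈ monicNonneg n ∧ ∀ Q ∈ monicNonneg n, momentForm P m ≤ momentForm Q m

end

/-! View the vector as a linear functional `L` on polynomials of degree at most `n`; a member of
`𝒫_n` is determined by its root set `s`. Realizability forces `L ≥ 0` on `𝒫_n` and `𝒫_{n-1}`, which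
gives the dichotomy.

The substance is the converse in (c), `HasFiniteRep.succ`. Assume that `L` is a finite nonnegative
combination of evaluations in degree `n` and positive on `𝒫_n`. Among the root sets of `𝒫_{n+1}`
take `s` minimizing `L`, ties broken by the least sum of roots, with minimum `a ≥ 0`. Place mass `a
/ P_s(N)` at a far point `N`; what remains of `L` annihilates `P_s`, so Lagrange interpolation
writes it as a combination of evaluations on `s`. The weight at `r` is, up to a correction vanishing
as `N → ∞`, `L(P_{s∖r}) / P_{s∖r}(r)`, and comparing `s` with the sets obtained by moving `r` to the
nearest free integer shows that its sign is right. The minimum exists because far roots can be moved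
inwards (`exists_bounded_le`), which needs a finitely supported representation, supplied by
`IsRepresented.hasFiniteRep`.

In (d), `L_P(m) = 0` confines every representing measure to the roots of `P`. It then has all
moments, and the integral of `x^i P` is zero, which pins down `m_n`. -/

/-- The moment functional `P ↦ L_P(m)` as a linear map. -/
noncomputable def momentFunctional {n : ℕ} (m : Fin n → ℝ) : ℝ[X] →ₗ[ℝ] ℝ :=
  ∑ k : Fin (n + 1), (Fin.cons 1 m : Fin (n + 1) → ℝ) k • Polynomial.lcoeff ℝ (k : ℕ)

/-- The monic polynomial whose roots are the elements of `s`, all simple. -/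
noncomputable def rootPoly (s : Finset ℕ) : ℝ[X] := Lagrange.nodal s (fun r : ℕ => (r : ℝ))

/-- The Lagrange basis polynomial at `r` for the nodes `s`. -/
noncomputable def nodeBasis (s : Finset ℕ) (r : ℕ) : ℝ[X] :=
  Lagrange.basis s (fun r : ℕ => (r : ℝ)) r

/-- The polynomial with root set `s` is nonnegative on `ℕ`. -/
def IsNonnegSet (s : Finset ℕ) : Prop := ∀ k : ℕ, 0 ≤ (rootPoly s).eval (k : ℝ)

/-- `L` is integration against `μ` on the polynomials of degree at most `n`. -/
def IsRepresented (L : ℝ[X] →ₗ[ℝ] ℝ) (n : ℕ) (μ : Measure ℕ) : Prop :=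
  ∀ P : ℝ[X], P.natDegree ≤ n →
    Integrable (fun x : ℕ => P.eval (x : ℝ)) μ ∧ ∫ x : ℕ, P.eval (x : ℝ) ∂μ = L P

/-- `L` is a nonnegative finite combination of evaluations at points of `ℕ` on the polynomials of
degree at most `n`. -/
def HasFiniteRep (L : ℝ[X] →ₗ[ℝ] ℝ) (n : ℕ) : Prop :=
  ∃ (s : Finset ℕ) (w : ℕ → ℝ), (∀ r ∈ s, 0 ≤ w r) ∧
    ∀ P : ℝ[X], P.natDegree ≤ n → L P = ∑ r ∈ s, w r * P.eval (r : ℝ)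

/-! ### Polynomials with simple natural roots, and Lagrange interpolation -/

theorem rootPoly_eval (s : Finset ℕ) (x : ℝ) :
    (rootPoly s).eval x = ∏ r ∈ s, (x - r) := by
  simp [rootPoly, Lagrange.eval_nodal]

theorem rootPoly_monic (s : Finset ℕ) : (rootPoly s).Monic := Lagrange.nodal_monic

theorem rootPoly_natDegree (s : Finset ℕ) : (rootPoly s).natDegree = s.card :=
  Lagrange.natDegree_nodal

theorem rootPoly_insert {s : Finset ℕ} {c : ℕ} (hc : c ∉ s) :
    rootPoly (insert c s) = (X - C (c : ℝ)) * rootPoly s := by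
  simp [rootPoly, Lagrange.nodal_insert_eq_nodal hc]

theorem rootPoly_erase {s : Finset ℕ} {r : ℕ} (hr : r ∈ s) :
    rootPoly s = (X - C (r : ℝ)) * rootPoly (s.erase r) := by
  rw [← rootPoly_insert (Finset.notMem_erase r s), Finset.insert_erase hr]

theorem rootPoly_eval_eq_zero_iff {s : Finset ℕ} {k : ℕ} :
    (rootPoly s).eval (k : ℝ) = 0 ↔ k ∈ s := by
  rw [rootPoly_eval, Finset.prod_eq_zero_iff]
  constructor
  · rintro ⟨r, hr, h⟩
    have : (k : ℝ) = r := by linarith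
    exact (Nat.cast_injective this) ▸ hr
  · exact fun h => ⟨k, h, by simp⟩

theorem mem_monicNonneg_iff {n : ℕ} {P : ℝ[X]} :
    P ∈ monicNonneg n ↔ ∃ s : Finset ℕ, s.card = n ∧ IsNonnegSet s ∧ P = rootPoly s := by
  constructor
  · rintro ⟨hm, hd, hc, hnn⟩
    -- `ncard` is 0 on infinite sets, so finiteness must come before the root count can be used.
    have hfin : {k : ℕ | P.eval (k : ℝ) = 0}.Finite := by
      refine ((P.roots.toFinset.finite_toSet).preimage
        (f := fun k : ℕ => (k : ℝ)) Nat.cast_injective.injOn).subset ?_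
      intro k hk
      simpa [hm.ne_zero] using hk
    have hcard : hfin.toFinset.card = n := by
      rw [← hc, Set.ncard_eq_toFinset_card _ hfin]
    have hP : P = rootPoly hfin.toFinset := by
      have hdvd : rootPoly hfin.toFinset ∣ P := by
        refine Finset.prod_dvd_of_coprime ?_ ?_
        · intro a _ b _ hab
          exact isCoprime_X_sub_C_of_isUnit_sub
            (sub_ne_zero.2 (Nat.cast_injective.ne hab)).isUnit
        · intro a ha
          exact dvd_iff_isRoot.2 (by simpa using ha)
      exact (eq_of_monic_of_dvd_of_natDegree_le (rootPoly_monic _) hm hdvd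
        (by rw [rootPoly_natDegree, hcard, hd]))
    exact ⟨_, hcard, fun k => hP ▸ hnn k, hP⟩
  · rintro ⟨s, hs, hnn, rfl⟩
    refine ⟨rootPoly_monic s, by rw [rootPoly_natDegree, hs], ?_, hnn⟩
    simp only [rootPoly_eval_eq_zero_iff]
    simpa using hs

theorem rootPoly_mem_monicNonneg {s : Finset ℕ} (hs : IsNonnegSet s) :
    rootPoly s ∈ monicNonneg s.card :=
  mem_monicNonneg_iff.2 ⟨s, rfl, hs, rfl⟩

theorem isNonnegSet_range (n : ℕ) : IsNonnegSet (Finset.range n) := by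
  intro k
  by_cases hk : k ∈ Finset.range n
  · exact (rootPoly_eval_eq_zero_iff.2 hk).ge
  · rw [rootPoly_eval]
    refine Finset.prod_nonneg fun r hr => ?_
    have : (r : ℝ) ≤ k := by
      simp only [Finset.mem_range] at hk hr
      exact_mod_cast (by omega : r ≤ k)
    linarith

theorem nodeBasis_eq {s : Finset ℕ} {r : ℕ} :
    nodeBasis s r =
      C (((rootPoly (s.erase r)).eval (r : ℝ))⁻¹) * rootPoly (s.erase r) := by
  simp only [nodeBasis, Lagrange.basis, Lagrange.basisDivisor, rootPoly, Lagrange.nodal,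
    Finset.prod_mul_distrib, eval_prod, eval_sub, eval_X, eval_C, ← Finset.prod_inv_distrib,
    map_prod]

theorem nodeBasis_natDegree_lt {s : Finset ℕ} {r : ℕ} (hr : r ∈ s) :
    (nodeBasis s r).natDegree < s.card := by
  rw [nodeBasis_eq]
  refine (natDegree_C_mul_le _ _).trans_lt ?_
  rw [rootPoly_natDegree]
  exact Finset.card_erase_lt_of_mem hr

theorem eval_nodeBasis {s : Finset ℕ} {r k : ℕ} (hr : r ∈ s) (hk : k ∈ s) :
    (nodeBasis s r).eval (k : ℝ) = if r = k then 1 else 0 := by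
  split_ifs with h
  · subst h
    exact Lagrange.eval_basis_self (v := fun r : ℕ => (r : ℝ)) Nat.cast_injective.injOn hr
  · exact Lagrange.eval_basis_of_ne (v := fun r : ℕ => (r : ℝ)) h hk

theorem eq_sum_nodeBasis {s : Finset ℕ} {P : ℝ[X]} (hP : P.degree < s.card) :
    P = ∑ r ∈ s, C (P.eval (r : ℝ)) * nodeBasis s r := by
  conv_lhs => rw [Lagrange.eq_interpolate (v := fun r : ℕ => (r : ℝ)) Nat.cast_injective.injOn hP]
  simp [Lagrange.interpolate_apply, nodeBasis]

/-- A functional that annihilates the polynomial with root set `s` is a combination of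
evaluations at the points of `s`. -/
theorem functional_eq_sum {L : ℝ[X] →ₗ[ℝ] ℝ} {s : Finset ℕ} (h0 : L (rootPoly s) = 0)
    {P : ℝ[X]} (hP : P.natDegree ≤ s.card) :
    L P = ∑ r ∈ s, L (nodeBasis s r) * P.eval (r : ℝ) := by
  set a := P.coeff s.card
  have hQ : (P - C a * rootPoly s).degree < s.card := by
    rw [degree_lt_iff_coeff_zero]
    intro k hk
    rcases hk.eq_or_lt with rfl | hk
    · have := (rootPoly_monic s).coeff_natDegree
      rw [rootPoly_natDegree] at this
      simp [this, a]
    · rw [coeff_sub, coeff_C_mul, coeff_eq_zero_of_natDegree_lt (hP.trans_lt hk),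
        coeff_eq_zero_of_natDegree_lt (by rwa [rootPoly_natDegree])]
      simp
  have h1 : L P = L (P - C a * rootPoly s) := by
    rw [map_sub, C_mul', map_smul, h0]; simp
  rw [h1, eq_sum_nodeBasis hQ, map_sum]
  refine Finset.sum_congr rfl fun r hr => ?_
  rw [C_mul', map_smul, smul_eq_mul, mul_comm, eval_sub, eval_mul,
    rootPoly_eval_eq_zero_iff.2 hr]
  simp

/-! ### Deleting and exchanging roots -/

theorem eval_erase_ne_zero (s : Finset ℕ) (r : ℕ) :
    (rootPoly (s.erase r)).eval (r : ℝ) ≠ 0 := by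
  rw [Ne, rootPoly_eval_eq_zero_iff]; simp

theorem eval_eq_mul_erase {s : Finset ℕ} {r : ℕ} (hr : r ∈ s) (x : ℝ) :
    (rootPoly s).eval x = (x - r) * (rootPoly (s.erase r)).eval x := by
  rw [rootPoly_erase hr]; simp

/-- Above `r` the removed factor is positive, and below `r` every integer remains a root. -/
theorem IsNonnegSet.erase {s : Finset ℕ} (hs : IsNonnegSet s) {r : ℕ} (hr : r ∈ s)
    (hpos : 0 < (rootPoly (s.erase r)).eval (r : ℝ)) (hlow : ∀ x < r, x ∈ s) :
    IsNonnegSet (s.erase r) := by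
  intro k
  rcases lt_trichotomy k r with h | rfl | h
  · exact (rootPoly_eval_eq_zero_iff.2 (Finset.mem_erase.2 ⟨h.ne, hlow k h⟩)).ge
  · exact hpos.le
  · have := hs k
    rw [eval_eq_mul_erase hr] at this
    have hk : (r : ℝ) < k := by exact_mod_cast h
    exact nonneg_of_mul_nonneg_right this (by linarith)

/-- Exchanging a root `r` for a non-root `c`, all integers between them being roots, preserves
nonnegativity when the exchanged polynomial is positive at `r`. -/
theorem IsNonnegSet.exchange {s : Finset ℕ} (hs : IsNonnegSet s) {r c : ℕ} (hr : r ∈ s)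
    (hc : c ∉ s) (hpos : 0 < ((r : ℝ) - c) * (rootPoly (s.erase r)).eval (r : ℝ))
    (hbtw : ∀ x, (c < x ∧ x < r ∨ r < x ∧ x < c) → x ∈ s) :
    IsNonnegSet (insert c (s.erase r)) := by
  intro k
  have hc' : c ∉ s.erase r := fun h => hc (Finset.mem_of_mem_erase h)
  rw [rootPoly_insert hc', eval_mul, eval_sub, eval_X, eval_C]
  by_cases hkr : k = r
  · subst hkr; exact hpos.le
  by_cases hks : k ∈ s
  · rw [rootPoly_eval_eq_zero_iff.2 (Finset.mem_erase.2 ⟨hkr, hks⟩), mul_zero]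
  by_cases hkc : k = c
  · simp [hkc]
  have h := hs k
  rw [eval_eq_mul_erase hr] at h
  -- A non-root `k` other than `c` lies on the same side of `c` and of `r`, so replacing the factor
  -- `k - r` by `k - c` keeps the sign.
  have hside : (k < c ∧ k < r) ∨ (c < k ∧ r < k) := by
    have := mt (hbtw k) hks
    omega
  rcases hside with ⟨h1, h2⟩ | ⟨h1, h2⟩
  · have h1 : (k : ℝ) < c := by exact_mod_cast h1
    have h2 : (k : ℝ) < r := by exact_mod_cast h2
    exact mul_nonneg_of_nonpos_of_nonpos (by linarith)
      (by by_contra hh; push Not at hh; nlinarith)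
  · have h1 : (c : ℝ) < k := by exact_mod_cast h1
    have h2 : (r : ℝ) < k := by exact_mod_cast h2
    exact mul_nonneg (by linarith) (nonneg_of_mul_nonneg_right h (by linarith))

theorem functional_exchange (L : ℝ[X] →ₗ[ℝ] ℝ) {s : Finset ℕ} {r c : ℕ} (hr : r ∈ s)
    (hc : c ∉ s) :
    L (rootPoly (insert c (s.erase r))) =
      L (rootPoly s) + ((r : ℝ) - c) * L (rootPoly (s.erase r)) := by
  have hc' : c ∉ s.erase r := fun h => hc (Finset.mem_of_mem_erase h)
  have h : rootPoly (insert c (s.erase r)) =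
      rootPoly s + ((r : ℝ) - c) • rootPoly (s.erase r) := by
    rw [rootPoly_insert hc', rootPoly_erase hr, smul_eq_C_mul, C_sub]; ring
  rw [h, map_add, map_smul, smul_eq_mul]

theorem card_exchange {s : Finset ℕ} {r c : ℕ} (hr : r ∈ s) (hc : c ∉ s) :
    (insert c (s.erase r)).card = s.card := by
  rw [Finset.card_insert_of_notMem (fun h => hc (Finset.mem_of_mem_erase h)),
    Finset.card_erase_add_one hr]

theorem sum_exchange_lt {s : Finset ℕ} {r c : ℕ} (hr : r ∈ s) (hc : c ∉ s) (h : c < r) :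
    ∑ x ∈ insert c (s.erase r), x < ∑ x ∈ s, x := by
  rw [Finset.sum_insert (fun h => hc (Finset.mem_of_mem_erase h)), ← Finset.add_sum_erase s _ hr]
  omega

theorem exists_greatest_gap_below {s : Finset ℕ} {r : ℕ} (h : ∃ x < r, x ∉ s) :
    ∃ c < r, c ∉ s ∧ ∀ x, c < x → x < r → x ∈ s := by
  induction r with
  | zero => obtain ⟨x, hx, _⟩ := h; omega
  | succ r ih =>
    by_cases hr : r ∈ s
    · obtain ⟨x, hx, hxs⟩ := h
      have hxr : x ≠ r := fun e => hxs (e ▸ hr)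
      obtain ⟨c, hc, hcs, hb⟩ := ih ⟨x, by omega, hxs⟩
      refine ⟨c, by omega, hcs, fun y hy hyr => ?_⟩
      rcases (Nat.lt_succ_iff.1 hyr).eq_or_lt with rfl | h'
      · exact hr
      · exact hb y hy h'
    · exact ⟨r, by omega, hr, fun y hy hyr => by omega⟩

theorem exists_least_gap_above (s : Finset ℕ) (r : ℕ) :
    ∃ c, r < c ∧ c ∉ s ∧ ∀ x, r < x → x < c → x ∈ s := by
  have hex : ∃ c, r < c ∧ c ∉ s :=
    ⟨max (r + 1) (s.sup id + 1), by omega, fun h => by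
      have := Finset.le_sup (f := id) h
      simp only [id] at this
      omega⟩
  classical
  refine ⟨Nat.find hex, (Nat.find_spec hex).1, (Nat.find_spec hex).2, fun x hx hlt => ?_⟩
  by_contra hxs
  exact Nat.find_min hex hlt ⟨hx, hxs⟩

/-! ### Minimizing root sets and the extension step -/

/-- If `L` is finitely represented in degree `n`, a nonnegative root set of size `n + 1` can be
moved into a bounded range without increasing `L`. -/
theorem exists_bounded_le {L : ℝ[X] →ₗ[ℝ] ℝ} {n : ℕ} (hL : HasFiniteRep L n) :
    ∃ B : ℕ, ∀ s : Finset ℕ, IsNonnegSet s → s.card = n + 1 →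
      ∃ t ⊆ Finset.range B, IsNonnegSet t ∧ t.card = n + 1 ∧
        L (rootPoly t) ≤ L (rootPoly s) ∧ ∑ x ∈ t, x ≤ ∑ x ∈ s, x := by
  obtain ⟨σ, w, hw, hrep⟩ := hL
  refine ⟨max (n + 1) (σ.sup id) + 1, fun s => ?_⟩
  induction hN : ∑ x ∈ s, x using Nat.strong_induction_on generalizing s with
  | _ N ih =>
  intro hs hcard
  by_cases hsub : s ⊆ Finset.range (max (n + 1) (σ.sup id) + 1)
  · exact ⟨s, hsub, hs, hcard, le_rfl, hN.le⟩
  obtain ⟨x, hxs, hx⟩ := Finset.not_subset.1 hsub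
  have hne : s.Nonempty := ⟨x, hxs⟩
  set r := s.max' hne with hrdef
  have hr : r ∈ s := s.max'_mem hne
  have hmax : ∀ y ∈ s, y ≤ r := fun y hy => s.le_max' y hy
  have hxr := hmax x hxs
  simp only [Finset.mem_range, not_lt] at hx
  -- The largest root exceeds `n + 1`, so the other `n` roots cannot fill all integers below it.
  obtain ⟨c, hcr, hc, hb⟩ : ∃ c < r, c ∉ s ∧ ∀ x, c < x → x < r → x ∈ s := by
    apply exists_greatest_gap_below
    by_contra! hall
    have : Finset.range r ⊆ s.erase r := fun y hy => by
      have hy := Finset.mem_range.1 hy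
      exact Finset.mem_erase.2 ⟨hy.ne, hall y hy⟩
    have := Finset.card_le_card this
    rw [Finset.card_range, Finset.card_erase_of_mem hr] at this
    omega
  have hcr' : (c : ℝ) < r := by exact_mod_cast hcr
  have hD : 0 < (rootPoly (s.erase r)).eval (r : ℝ) := by
    rw [rootPoly_eval]
    refine Finset.prod_pos fun y hy => ?_
    have hy' := hmax y (Finset.mem_of_mem_erase hy)
    have hlt : y < r := lt_of_le_of_ne hy' (Finset.ne_of_mem_erase hy)
    have : (y : ℝ) < r := by exact_mod_cast hlt
    linarith
  -- All support points lie below `r`, where `x - r < 0` makes the remaining factor nonpositive.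
  -- Moving `r` down therefore does not increase `L`.
  have hLE : L (rootPoly (s.erase r)) ≤ 0 := by
    rw [hrep _ (by rw [rootPoly_natDegree, Finset.card_erase_of_mem hr]; omega)]
    refine Finset.sum_nonpos fun y hy => mul_nonpos_of_nonneg_of_nonpos (hw y hy) ?_
    have hyσ : y ≤ σ.sup id := Finset.le_sup (f := id) hy
    have hyr : y < r := by omega
    have hyr : (y : ℝ) < r := by exact_mod_cast hyr
    have h := hs y
    rw [eval_eq_mul_erase hr] at h
    by_contra hh
    push Not at hh
    nlinarith
  have hs' : IsNonnegSet (insert c (s.erase r)) :=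
    hs.exchange hr hc (mul_pos (by linarith) hD) (by
      rintro x (⟨h1, h2⟩ | ⟨h1, h2⟩)
      · exact hb x h1 h2
      · omega)
  have hlt := sum_exchange_lt hr hc hcr
  obtain ⟨t, ht, ht1, ht2, ht3, ht4⟩ := ih _ (hN ▸ hlt) _ rfl hs' (by rw [card_exchange hr hc, hcard])
  refine ⟨t, ht, ht1, ht2, ht3.trans ?_, by omega⟩
  rw [functional_exchange L hr hc]
  have := mul_nonpos_of_nonneg_of_nonpos (sub_nonneg.2 hcr'.le) hLE
  linarith

/-- There is a minimizing root set that moreover has the least sum of roots. -/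
theorem exists_lex_minimizer {L : ℝ[X] →ₗ[ℝ] ℝ} {n : ℕ} (hL : HasFiniteRep L n) :
    ∃ s : Finset ℕ, IsNonnegSet s ∧ s.card = n + 1 ∧
      ∀ t : Finset ℕ, IsNonnegSet t → t.card = n + 1 →
        L (rootPoly s) ≤ L (rootPoly t) ∧
          (L (rootPoly t) ≤ L (rootPoly s) → ∑ x ∈ s, x ≤ ∑ x ∈ t, x) := by
  classical
  obtain ⟨B, hB⟩ := exists_bounded_le hL
  set T := (Finset.range B).powerset.filter (fun t => IsNonnegSet t ∧ t.card = n + 1) with hT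
  obtain ⟨t₀, h1, h2, h3, _⟩ := hB _ (isNonnegSet_range (n + 1)) (Finset.card_range _)
  have hne : T.Nonempty := ⟨t₀, by simp [hT, h1, h2, h3]⟩
  obtain ⟨s, hsT, hmin⟩ :=
    T.exists_min_image (fun t => toLex (L (rootPoly t), ∑ x ∈ t, x)) hne
  simp only [hT, Finset.mem_filter, Finset.mem_powerset] at hsT hmin
  refine ⟨s, hsT.2.1, hsT.2.2, fun t ht htc => ?_⟩
  obtain ⟨t', k1, k2, k3, k4, k5⟩ := hB t ht htc
  have := hmin t' ⟨k1, k2, k3⟩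
  rw [Prod.Lex.le_iff] at this
  simp only [ofLex_toLex] at this
  rcases this with h | ⟨h, h'⟩
  · exact ⟨(h.trans_le k4).le, fun hh => absurd (h.trans_le k4) (not_lt.2 hh)⟩
  · exact ⟨h.trans_le k4, fun _ => h'.trans k5⟩

/-- The extension step: a functional that is finitely represented in degree `n`, positive on the
nonnegative root polynomials of degree `n` and nonnegative on those of degree `n + 1` is finitely
represented in degree `n + 1`. -/
theorem HasFiniteRep.succ {L : ℝ[X] →ₗ[ℝ] ℝ} {n : ℕ} (hL : HasFiniteRep L n)
    (hpos : ∀ s : Finset ℕ, IsNonnegSet s → s.card = n → 0 < L (rootPoly s))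
    (hnn : ∀ s : Finset ℕ, IsNonnegSet s → s.card = n + 1 → 0 ≤ L (rootPoly s)) :
    HasFiniteRep L (n + 1) := by
  obtain ⟨s, hs, hcard, hmin⟩ := exists_lex_minimizer hL
  set a := L (rootPoly s) with ha
  have ha0 : 0 ≤ a := hnn s hs hcard
  -- The tie-break yields the strict inequality: moving `r` down lowers the root sum, so it must
  -- strictly increase `L`. If there is no gap below `r`, deleting `r` leaves a member of `𝒫_n`,
  -- where `L` is positive.
  have hup : ∀ r ∈ s, 0 < (rootPoly (s.erase r)).eval (r : ℝ) →
      0 < L (rootPoly (s.erase r)) := by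
    intro r hr hD
    by_cases hlow : ∀ x < r, x ∈ s
    · exact hpos _ (hs.erase hr hD hlow) (by rw [Finset.card_erase_of_mem hr, hcard]; rfl)
    · push Not at hlow
      obtain ⟨c, hcr, hc, hb⟩ := exists_greatest_gap_below hlow
      have hcr' : (c : ℝ) < r := by exact_mod_cast hcr
      have hs' : IsNonnegSet (insert c (s.erase r)) :=
        hs.exchange hr hc (mul_pos (by linarith) hD) (by
          rintro x (⟨h1, h2⟩ | ⟨h1, h2⟩)
          · exact hb x h1 h2
          · omega)
      obtain ⟨_, h2⟩ := hmin _ hs' (by rw [card_exchange hr hc, hcard])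
      have h3 := mt h2 (not_le.2 (sum_exchange_lt hr hc hcr))
      rw [functional_exchange L hr hc, not_le] at h3
      exact pos_of_mul_pos_right (a := (r : ℝ) - c) (by linarith) (by linarith)
  -- Here `r` moves up, and plain minimality suffices: the correction due to `N` only helps a
  -- negative denominator.
  have hdown : ∀ r ∈ s, (rootPoly (s.erase r)).eval (r : ℝ) < 0 →
      L (rootPoly (s.erase r)) ≤ 0 := by
    intro r hr hD
    obtain ⟨c, hrc, hc, hb⟩ := exists_least_gap_above s r
    have hrc' : (r : ℝ) < c := by exact_mod_cast hrc
    have hs' : IsNonnegSet (insert c (s.erase r)) :=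
      hs.exchange hr hc (mul_pos_of_neg_of_neg (by linarith) hD) (by
        rintro x (⟨h1, h2⟩ | ⟨h1, h2⟩)
        · omega
        · exact hb x h1 h2)
    obtain ⟨h1, _⟩ := hmin _ hs' (by rw [card_exchange hr hc, hcard])
    rw [functional_exchange L hr hc] at h1
    by_contra hh
    push Not at hh
    nlinarith
  -- The correction to `L(P_{s∖r})` will be `a / (N - r)`, which strict positivity absorbs for large
  -- `N`.
  obtain ⟨N, hN⟩ : ∃ N : ℕ, ∀ r ∈ s, r < N ∧
      (0 < (rootPoly (s.erase r)).eval (r : ℝ) →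
        a ≤ L (rootPoly (s.erase r)) * ((N : ℝ) - r)) := by
    refine Filter.Eventually.exists (f := Filter.atTop) ?_
    rw [Filter.eventually_all_finset]
    intro r hr
    refine (Filter.eventually_gt_atTop r).and ?_
    by_cases hD : 0 < (rootPoly (s.erase r)).eval (r : ℝ)
    · have ht : Filter.Tendsto (fun N : ℕ => L (rootPoly (s.erase r)) * ((N : ℝ) - r))
          Filter.atTop Filter.atTop :=
        (Filter.tendsto_atTop_add_const_right _ (-(r : ℝ))
          tendsto_natCast_atTop_atTop).const_mul_atTop (hup r hr hD)
      exact (ht.eventually_ge_atTop a).mono fun _ h _ => h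
    · exact Filter.Eventually.of_forall fun _ h => absurd h hD
  have hNs : N ∉ s := fun h => (hN N h).1.false
  have hPN : 0 < (rootPoly s).eval (N : ℝ) :=
    lt_of_le_of_ne (hs N) (fun h => hNs (rootPoly_eval_eq_zero_iff.1 h.symm))
  -- The mass at `N` that makes the remaining functional annihilate `P_s`.
  set ε := a / (rootPoly s).eval (N : ℝ) with hε
  set L' : ℝ[X] →ₗ[ℝ] ℝ := L - ε • Polynomial.leval (N : ℝ) with hL'
  have hL'app : ∀ P, L' P = L P - ε * P.eval (N : ℝ) := fun P => by simp [hL', leval]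
  have hL'0 : L' (rootPoly s) = 0 := by
    rw [hL'app, hε, div_mul_cancel₀ _ hPN.ne', sub_self]
  refine ⟨insert N s, fun r => if r = N then ε else L' (nodeBasis s r), ?_, ?_⟩
  · intro r hr
    rcases Finset.mem_insert.1 hr with rfl | hr
    · simp only [if_true]
      exact div_nonneg ha0 hPN.le
    · have hrN : r ≠ N := fun h => hNs (h ▸ hr)
      simp only [if_neg hrN]
      have hrN' : (0 : ℝ) < N - r := by
        have : (r : ℝ) < N := by exact_mod_cast (hN r hr).1
        linarith
      have hEN : ε * (rootPoly (s.erase r)).eval (N : ℝ) = a / (N - r) := by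
        rw [hε, eval_eq_mul_erase hr]
        have : (rootPoly (s.erase r)).eval (N : ℝ) ≠ 0 := fun h =>
          hNs (Finset.mem_of_mem_erase (rootPoly_eval_eq_zero_iff.1 h))
        field_simp
      have hval : L' (nodeBasis s r) = ((rootPoly (s.erase r)).eval (r : ℝ))⁻¹ *
          (L (rootPoly (s.erase r)) - a / (N - r)) := by
        rw [nodeBasis_eq, C_mul', map_smul, smul_eq_mul, hL'app, hEN]
      rw [hval]
      rcases (eval_erase_ne_zero s r).lt_or_gt with hD | hD
      · refine mul_nonneg_of_nonpos_of_nonpos (inv_nonpos.2 hD.le) ?_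
        have := hdown r hr hD
        have := div_nonneg ha0 hrN'.le
        linarith
      · refine mul_nonneg (inv_nonneg.2 hD.le) (sub_nonneg.2 ?_)
        rw [div_le_iff₀ hrN']
        exact (hN r hr).2 hD
  · intro P hP
    have h := functional_eq_sum hL'0 (hP.trans hcard.ge)
    rw [hL'app] at h
    rw [Finset.sum_insert hNs]
    beta_reduce
    rw [if_pos rfl,
      Finset.sum_congr rfl fun r hr => by rw [if_neg (fun h : r = N => hNs (h ▸ hr))], ← h]
    ring

/-! ### Representing measures and finite support -/

theorem IsRepresented.mono {L : ℝ[X] →ₗ[ℝ] ℝ} {n k : ℕ} {μ : Measure ℕ}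
    (h : IsRepresented L n μ) (hk : k ≤ n) : IsRepresented L k μ :=
  fun P hP => h P (hP.trans hk)

theorem IsRepresented.nonneg {L : ℝ[X] →ₗ[ℝ] ℝ} {n : ℕ} {μ : Measure ℕ}
    (h : IsRepresented L n μ) {P : ℝ[X]} (hP : P.natDegree ≤ n)
    (hnn : ∀ k : ℕ, 0 ≤ P.eval (k : ℝ)) : 0 ≤ L P := by
  rw [← (h P hP).2]
  exact integral_nonneg hnn

/-- A nonnegative function with nonpositive integral vanishes almost everywhere, so the measure
lives on its zero set. -/
theorem IsRepresented.ae_mem {L : ℝ[X] →ₗ[ℝ] ℝ} {n : ℕ} {μ : Measure ℕ}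
    (h : IsRepresented L n μ) {s : Finset ℕ} (hs : IsNonnegSet s) (hcard : s.card ≤ n)
    (h0 : L (rootPoly s) ≤ 0) : ∀ᵐ x ∂μ, x ∈ s := by
  obtain ⟨hi, he⟩ := h (rootPoly s) (by rwa [rootPoly_natDegree])
  have hzero : ∫ x : ℕ, (rootPoly s).eval (x : ℝ) ∂μ = 0 :=
    le_antisymm (he ▸ h0) (integral_nonneg hs)
  rw [integral_eq_zero_iff_of_nonneg hs hi] at hzero
  filter_upwards [hzero] with x hx
  exact rootPoly_eval_eq_zero_iff.1 hx

/-- On a measure carried by `s`, every polynomial is integrable and its integral is given by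
Lagrange interpolation at the points of `s`. -/
theorem integrable_integral_of_ae_mem {μ : Measure ℕ} {s : Finset ℕ} (hμ : ∀ᵐ x ∂μ, x ∈ s)
    (hb : ∀ r ∈ s, Integrable (fun x : ℕ => (nodeBasis s r).eval (x : ℝ)) μ) (P : ℝ[X]) :
    Integrable (fun x : ℕ => P.eval (x : ℝ)) μ ∧
      ∫ x : ℕ, P.eval (x : ℝ) ∂μ =
        ∑ r ∈ s, (∫ x : ℕ, (nodeBasis s r).eval (x : ℝ) ∂μ) * P.eval (r : ℝ) := by
  have hae : (fun x : ℕ => P.eval (x : ℝ)) =ᵐ[μ]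
      fun x : ℕ => ∑ r ∈ s, (nodeBasis s r).eval (x : ℝ) * P.eval (r : ℝ) := by
    filter_upwards [hμ] with x hx
    rw [Finset.sum_eq_single_of_mem x hx]
    · rw [eval_nodeBasis hx hx, if_pos rfl, one_mul]
    · intro r hr hrx
      rw [eval_nodeBasis hr hx, if_neg hrx, zero_mul]
  refine ⟨(integrable_finsetSum s fun r hr => (hb r hr).mul_const _).congr hae.symm, ?_⟩
  rw [integral_congr_ae hae, integral_finsetSum s fun r hr => (hb r hr).mul_const _]
  simp only [integral_mul_const]

theorem IsRepresented.integrable_nodeBasis {L : ℝ[X] →ₗ[ℝ] ℝ} {n : ℕ} {μ : Measure ℕ}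
    (h : IsRepresented L n μ) {s : Finset ℕ} (hcard : s.card ≤ n + 1) :
    ∀ r ∈ s, Integrable (fun x : ℕ => (nodeBasis s r).eval (x : ℝ)) μ := fun r hr =>
  (h _ (by have := nodeBasis_natDegree_lt hr; omega)).1

theorem IsRepresented.hasFiniteRep_of_ae_mem {L : ℝ[X] →ₗ[ℝ] ℝ} {n : ℕ} {μ : Measure ℕ}
    (h : IsRepresented L n μ) {s : Finset ℕ} (hcard : s.card ≤ n + 1) (hμ : ∀ᵐ x ∂μ, x ∈ s) :
    HasFiniteRep L n := by
  refine ⟨s, fun r => ∫ x : ℕ, (nodeBasis s r).eval (x : ℝ) ∂μ, fun r hr => ?_, fun P hP => ?_⟩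
  · refine integral_nonneg_of_ae ?_
    filter_upwards [hμ] with x hx
    simp only [Pi.zero_apply]
    rw [eval_nodeBasis hr hx]
    split_ifs <;> norm_num
  · rw [← (h P hP).2]
    exact (integrable_integral_of_ae_mem hμ (h.integrable_nodeBasis hcard) P).2

/-- A functional represented by a measure in degree `n` is represented there by a finitely
supported one. -/
theorem IsRepresented.hasFiniteRep {L : ℝ[X] →ₗ[ℝ] ℝ} {n : ℕ} {μ : Measure ℕ}
    (h : IsRepresented L n μ) : HasFiniteRep L n := by
  induction n with
  | zero =>
    refine ⟨{0}, fun _ => L 1, fun _ _ => h.nonneg (P := 1) (by simp) (by simp), fun P hP => ?_⟩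
    rw [eq_C_of_natDegree_le_zero hP, ← mul_one (C _), C_mul', map_smul]
    simp [mul_comm]
  | succ n ih =>
    -- Either the extension step applies, or some `P_s` of degree `n` has `L(P_s) ≤ 0` and the
    -- measure already sits on `s`.
    by_cases hpos : ∀ s : Finset ℕ, IsNonnegSet s → s.card = n → 0 < L (rootPoly s)
    · exact (ih (h.mono n.le_succ)).succ hpos fun s hs hc =>
        h.nonneg (by rw [rootPoly_natDegree, hc]) hs
    · push Not at hpos
      obtain ⟨s, hs, hc, h0⟩ := hpos
      exact h.hasFiniteRep_of_ae_mem (by omega) (h.ae_mem hs (by omega) h0)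

theorem HasFiniteRep.isRepresented {L : ℝ[X] →ₗ[ℝ] ℝ} {n : ℕ} (h : HasFiniteRep L n)
    (h1 : L 1 = 1) : ∃ μ : Measure ℕ, IsProbabilityMeasure μ ∧ IsRepresented L n μ := by
  obtain ⟨s, w, hw, hrep⟩ := h
  have hint : ∀ (f : ℕ → ℝ), ∀ r ∈ s,
      Integrable f (ENNReal.ofReal (w r) • Measure.dirac r) := fun f r _ =>
    (integrable_dirac (by simp)).smul_measure ENNReal.ofReal_ne_top
  refine ⟨∑ r ∈ s, ENNReal.ofReal (w r) • Measure.dirac r, ⟨?_⟩, fun P hP => ⟨?_, ?_⟩⟩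
  · have := hrep 1 (by simp)
    rw [h1] at this
    simp only [eval_one, mul_one] at this
    simp only [Measure.coe_finsetSum, Finset.sum_apply, Measure.smul_apply, measure_univ,
      smul_eq_mul, mul_one]
    rw [← ENNReal.ofReal_sum_of_nonneg hw, ← this, ENNReal.ofReal_one]
  · exact integrable_finsetSum_measure.2 (hint _)
  · rw [integral_finsetSum_measure (hint _), hrep P hP]
    refine Finset.sum_congr rfl fun r hr => ?_
    rw [integral_smul_measure, integral_dirac, ENNReal.toReal_ofReal (hw r hr), smul_eq_mul]

/-! ### Moment vectors as functionals; the I-realizable case -/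

theorem momentForm_eq {n : ℕ} (P : ℝ[X]) (m : Fin n → ℝ) :
    momentForm P m = momentFunctional m P := by
  simp [momentForm, momentFunctional, mul_comm]

theorem momentFunctional_one {n : ℕ} (m : Fin n → ℝ) : momentFunctional m 1 = 1 := by
  rw [← momentForm_eq, momentForm, Fin.sum_univ_succ]
  simp [coeff_one]

theorem momentFunctional_X_pow {n : ℕ} (m : Fin n → ℝ) (k : Fin n) :
    momentFunctional m (X ^ ((k : ℕ) + 1)) = m k := by
  rw [← momentForm_eq, momentForm, Finset.sum_eq_single k.succ]
  · simp
  · intro b _ hb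
    rw [coeff_X_pow, if_neg, zero_mul]
    intro h
    exact hb (Fin.ext (by simpa using h))
  · simp

theorem momentFunctional_dropLast {n : ℕ} (m : Fin (n + 1) → ℝ) {P : ℝ[X]}
    (hP : P.natDegree ≤ n) : momentFunctional (dropLast m) P = momentFunctional m P := by
  rw [← momentForm_eq, ← momentForm_eq, momentForm, momentForm, Fin.sum_univ_castSucc (n := n + 1),
    Fin.val_last, coeff_eq_zero_of_natDegree_lt (Nat.lt_succ_of_le hP), zero_mul, add_zero]
  refine Finset.sum_congr rfl fun k _ => ?_
  refine congrArg₂ _ rfl ?_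
  refine Fin.cases ?_ (fun j => ?_) k
  · rfl
  · rfl

theorem realizable_iff {n : ℕ} (m : Fin n → ℝ) :
    Realizable m ↔
      ∃ μ : Measure ℕ, IsProbabilityMeasure μ ∧ IsRepresented (momentFunctional m) n μ := by
  refine exists_congr fun μ => and_congr_right fun hμ => ⟨fun h P hP => ?_, fun h k => ?_⟩
  · have hk : ∀ i ∈ Finset.range (n + 1), Integrable (fun x : ℕ => (x : ℝ) ^ i) μ ∧
        ∫ x : ℕ, (x : ℝ) ^ i ∂μ = momentFunctional m (X ^ i) := by
      rintro (_ | i) hi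
      · simp [momentFunctional_one]
      · have := h ⟨i, by simpa using hi⟩
        exact ⟨this.1, this.2.trans (momentFunctional_X_pow m ⟨i, by simpa using hi⟩).symm⟩
    have hsum : ∀ x : ℝ, P.eval x = ∑ i ∈ Finset.range (n + 1), P.coeff i * x ^ i := fun x =>
      eval_eq_sum_range' (Nat.lt_succ_of_le hP) x
    simp only [hsum]
    refine ⟨integrable_finsetSum _ fun i hi => (hk i hi).1.const_mul _, ?_⟩
    rw [integral_finsetSum _ fun i hi => (hk i hi).1.const_mul _]
    conv_rhs => rw [P.as_sum_range' (n + 1) (Nat.lt_succ_of_le hP), map_sum]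
    refine Finset.sum_congr rfl fun i hi => ?_
    rw [integral_const_mul, (hk i hi).2, ← C_mul_X_pow_eq_monomial, C_mul', map_smul, smul_eq_mul]
  · have := h (X ^ ((k : ℕ) + 1)) (by rw [natDegree_X_pow]; exact k.2)
    simpa [momentFunctional_X_pow] using this

theorem Realizable.momentForm_nonneg {n k : ℕ} {m : Fin n → ℝ} (h : Realizable m) {P : ℝ[X]}
    (hP : P ∈ monicNonneg k) (hk : k ≤ n) : 0 ≤ momentForm P m := by
  obtain ⟨μ, _, hμ⟩ := (realizable_iff m).1 h
  rw [momentForm_eq]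
  exact hμ.nonneg (hP.2.1.trans_le hk) hP.2.2.2

theorem Realizable.dropLast {n : ℕ} {m : Fin (n + 1) → ℝ} (h : Realizable m) :
    Realizable (dropLast m) := by
  obtain ⟨μ, h1, hμ⟩ := (realizable_iff m).1 h
  refine (realizable_iff _).2 ⟨μ, h1, fun P hP => ?_⟩
  rw [momentFunctional_dropLast m hP]
  exact hμ P (hP.trans n.le_succ)

theorem isRepresented_of_dropLast {n : ℕ} {m : Fin (n + 1) → ℝ} (h : Realizable (_root_.dropLast m)) :
    ∃ μ : Measure ℕ, IsProbabilityMeasure μ ∧ IsRepresented (momentFunctional m) n μ := by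
  obtain ⟨μ, h1, hμ⟩ := (realizable_iff _).1 h
  refine ⟨μ, h1, fun P hP => ?_⟩
  rw [← momentFunctional_dropLast m hP]
  exact hμ P hP

theorem Realizable.iRealizable_or_bRealizable {n : ℕ} {m : Fin n → ℝ} (h : Realizable m) :
    IRealizable m ∨ BRealizable m := by
  by_cases hb : BRealizable m
  · exact Or.inr hb
  · refine Or.inl ⟨h, fun P hP => lt_of_le_of_ne ?_ fun h0 => hb ⟨h, P, hP, h0.symm⟩⟩
    rcases hP with hP | hP
    · exact h.momentForm_nonneg hP le_rfl
    · exact h.momentForm_nonneg hP (Nat.sub_le n 1)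

theorem not_iRealizable_and_bRealizable {n : ℕ} {m : Fin n → ℝ} :
    ¬ (IRealizable m ∧ BRealizable m) := by
  rintro ⟨⟨_, h⟩, ⟨_, P, hP, h0⟩⟩
  exact (h P hP).ne' h0

theorem momentForm_dropLast {n k : ℕ} {m : Fin (n + 1) → ℝ} {P : ℝ[X]}
    (hP : P ∈ monicNonneg k) (hk : k ≤ n) : momentForm P (dropLast m) = momentForm P m := by
  rw [momentForm_eq, momentForm_eq]
  exact momentFunctional_dropLast m (hP.2.1.trans_le hk)

theorem exists_isMinimizing {n : ℕ} {m : Fin (n + 1) → ℝ} (h : Realizable (dropLast m)) :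
    ∃ P : ℝ[X], IsMinimizing P m := by
  obtain ⟨μ, _, hμ⟩ := isRepresented_of_dropLast h
  obtain ⟨s, hs, hc, hmin⟩ := exists_lex_minimizer hμ.hasFiniteRep
  refine ⟨rootPoly s, hc ▸ rootPoly_mem_monicNonneg hs, fun Q hQ => ?_⟩
  obtain ⟨t, htc, ht, rfl⟩ := mem_monicNonneg_iff.1 hQ
  rw [momentForm_eq, momentForm_eq]
  exact (hmin t ht htc).1

theorem realizable_of_isMinimizing {n : ℕ} {m : Fin (n + 1) → ℝ} (h : IRealizable (dropLast m))
    {P : ℝ[X]} (hP : IsMinimizing P m) (h0 : 0 ≤ momentForm P m) : Realizable m := by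
  obtain ⟨μ, _, hμ⟩ := isRepresented_of_dropLast h.1
  refine (realizable_iff m).2
    ((hμ.hasFiniteRep.succ (fun s hs hc => ?_) fun s hs hc => ?_).isRepresented
      (momentFunctional_one m))
  · have hmem : rootPoly s ∈ monicNonneg n := hc ▸ rootPoly_mem_monicNonneg hs
    rw [← momentForm_eq, ← momentForm_dropLast hmem le_rfl]
    exact h.2 _ (Or.inl hmem)
  · rw [← momentForm_eq]
    exact h0.trans (hP.2 _ (hc ▸ rootPoly_mem_monicNonneg hs))

theorem trichotomy_of_isMinimizing {n : ℕ} {m : Fin (n + 1) → ℝ} (h : IRealizable (dropLast m))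
    {P : ℝ[X]} (hP : IsMinimizing P m) :
    (Realizable m ↔ 0 ≤ momentForm P m) ∧ (0 < momentForm P m → IRealizable m) ∧
      (momentForm P m = 0 → BRealizable m) := by
  refine ⟨⟨fun hr => hr.momentForm_nonneg hP.1 le_rfl, realizable_of_isMinimizing h hP⟩,
    fun h0 => ⟨realizable_of_isMinimizing h hP h0.le, ?_⟩,
    fun h0 => ⟨realizable_of_isMinimizing h hP h0.ge, P, Or.inl hP.1, h0⟩⟩
  rintro Q (hQ | hQ)
  · exact h0.trans_le (hP.2 Q hQ)
  · rw [← momentForm_dropLast hQ (Nat.le_refl n)]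
    exact h.2 Q (Or.inl hQ)

/-! ### The B-realizable case -/

/-- Every nonnegative root set extends by two adjacent roots. -/
theorem IsNonnegSet.exists_extend {s : Finset ℕ} (hs : IsNonnegSet s) :
    ∃ t, s ⊆ t ∧ t.card = s.card + 2 ∧ IsNonnegSet t := by
  -- The new roots `a` and `a + 1` lie beyond `s`; no integer falls strictly between them, so their
  -- factors have nonnegative product on `ℕ`.
  set a := s.sup id + 1 with ha
  have hmax : ∀ x ∈ s, x < a := fun x hx => Nat.lt_succ_of_le (Finset.le_sup (f := id) hx)
  have h1 : a + 1 ∉ s := fun h => by have := hmax _ h; omega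
  have h2 : a ∉ insert (a + 1) s := fun h => by
    rcases Finset.mem_insert.1 h with h | h
    · omega
    · exact (hmax _ h).false
  refine ⟨insert a (insert (a + 1) s), fun x hx => by simp [hx], ?_, fun k => ?_⟩
  · rw [Finset.card_insert_of_notMem h2, Finset.card_insert_of_notMem h1]
  · rw [rootPoly_insert h2, rootPoly_insert h1, eval_mul, eval_mul, ← mul_assoc]
    refine mul_nonneg ?_ (hs k)
    simp only [eval_sub, eval_X, eval_C]
    rcases Nat.lt_or_ge a k with h | h
    · have : (a : ℝ) + 1 ≤ k := by exact_mod_cast h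
      push_cast
      exact mul_nonneg (by linarith) (by linarith)
    · have : (k : ℝ) ≤ a := by exact_mod_cast h
      push_cast
      exact mul_nonneg_of_nonpos_of_nonpos (by linarith) (by linarith)

theorem IsRepresented.eq_zero_of_ae_mem {L : ℝ[X] →ₗ[ℝ] ℝ} {n : ℕ} {μ : Measure ℕ}
    (h : IsRepresented L n μ) {s : Finset ℕ} (hμ : ∀ᵐ x ∂μ, x ∈ s) {P : ℝ[X]}
    (hP : P.natDegree ≤ n) (hs : ∀ x ∈ s, P.eval (x : ℝ) = 0) : L P = 0 := by
  rw [← (h P hP).2]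
  refine integral_eq_zero_of_ae ?_
  filter_upwards [hμ] with x hx
  exact hs x hx

theorem X_pow_mul_rootPoly_monic (i : ℕ) (s : Finset ℕ) : (X ^ i * rootPoly s).Monic :=
  (monic_X_pow i).mul (rootPoly_monic s)

theorem X_pow_mul_rootPoly_natDegree (i : ℕ) (s : Finset ℕ) :
    (X ^ i * rootPoly s).natDegree = i + s.card := by
  rw [(monic_X_pow i).natDegree_mul (rootPoly_monic s), natDegree_X_pow, rootPoly_natDegree]

theorem X_pow_mul_rootPoly_eval_eq_zero (i : ℕ) {s : Finset ℕ} {x : ℕ} (hx : x ∈ s) :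
    (X ^ i * rootPoly s).eval (x : ℝ) = 0 := by
  rw [eval_mul, rootPoly_eval_eq_zero_iff.2 hx, mul_zero]

theorem Realizable.momentForm_X_pow_mul_eq_zero {n i : ℕ} {m : Fin n → ℝ} {s : Finset ℕ}
    (h : Realizable m) (hs : IsNonnegSet s) (hi : i + s.card = n)
    (h0 : momentForm (rootPoly s) m = 0) : momentForm (X ^ i * rootPoly s) m = 0 := by
  obtain ⟨μ, _, hμ⟩ := (realizable_iff m).1 h
  rw [momentForm_eq] at h0 ⊢
  exact hμ.eq_zero_of_ae_mem (hμ.ae_mem hs (by omega) h0.le)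
    (by rw [X_pow_mul_rootPoly_natDegree, hi]) fun x hx => X_pow_mul_rootPoly_eval_eq_zero i hx

/-- The measure representing the shorter vector sits on `s`, so it works in degree `n + 1` too: `X^i
* P_s` is monic of that degree and is killed both by the functional and by the measure, and
subtracting a multiple of it lowers the degree. -/
theorem realizable_of_momentForm_X_pow_mul_eq_zero {n i : ℕ} {m : Fin (n + 1) → ℝ}
    {s : Finset ℕ} (h : Realizable (dropLast m)) (hs : IsNonnegSet s) (hi : i + s.card = n + 1)
    (hi0 : 0 < i) (h0 : momentForm (rootPoly s) m = 0)
    (hX : momentForm (X ^ i * rootPoly s) m = 0) : Realizable m := by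
  obtain ⟨μ, h1, hμ⟩ := isRepresented_of_dropLast h
  refine (realizable_iff m).2 ⟨μ, h1, fun P hP => ?_⟩
  rw [momentForm_eq] at h0 hX
  have hae := hμ.ae_mem hs (by omega) h0.le
  have hint := fun Q =>
    (integrable_integral_of_ae_mem hae (hμ.integrable_nodeBasis (by omega)) Q).1
  refine ⟨hint P, ?_⟩
  set T := X ^ i * rootPoly s with hT
  have hTd : T.natDegree = n + 1 := by rw [hT, X_pow_mul_rootPoly_natDegree, hi]
  have hTm : T.Monic := X_pow_mul_rootPoly_monic i s
  set Q := P - C (P.coeff (n + 1)) * T with hQ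
  have hQd : Q.natDegree ≤ n := by
    rw [natDegree_le_iff_coeff_eq_zero]
    intro k hk
    rcases (Nat.succ_le_of_lt hk).eq_or_lt with rfl | hk
    · have := hTm.coeff_natDegree
      rw [hTd] at this
      simp [hQ, this]
    · rw [hQ, coeff_sub, coeff_C_mul, coeff_eq_zero_of_natDegree_lt (hP.trans_lt hk),
        coeff_eq_zero_of_natDegree_lt (hTd.trans_lt hk)]
      simp
  have hL : momentFunctional m P = momentFunctional m Q := by
    rw [hQ, map_sub, C_mul', map_smul, hX]; simp
  rw [hL, ← (hμ Q hQd).2]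
  refine integral_congr_ae ?_
  filter_upwards [hae] with x hx
  rw [hQ, eval_sub, eval_mul, hT, X_pow_mul_rootPoly_eval_eq_zero i hx]
  simp

/-- For `i = 2` the witness has degree too low for the definition; two extra roots lift it to `𝒫_n`,
and it still vanishes on the support. -/
theorem Realizable.bRealizable_of_eq_zero {n i : ℕ} {m : Fin n → ℝ} {s : Finset ℕ}
    (h : Realizable m) (hs : IsNonnegSet s) (hn : i + s.card = n) (hi : i = 1 ∨ i = 2)
    (h0 : momentForm (rootPoly s) m = 0) : BRealizable m := by
  refine ⟨h, ?_⟩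
  rcases hi with rfl | rfl
  · refine ⟨rootPoly s, Or.inr ?_, h0⟩
    rw [show n - 1 = s.card by omega]
    exact rootPoly_mem_monicNonneg hs
  · obtain ⟨t, hst, htc, ht⟩ := hs.exists_extend
    obtain ⟨μ, _, hμ⟩ := (realizable_iff m).1 h
    refine ⟨rootPoly t, Or.inl ?_, ?_⟩
    · rw [show n = t.card by omega]
      exact rootPoly_mem_monicNonneg ht
    · rw [momentForm_eq] at h0 ⊢
      exact hμ.eq_zero_of_ae_mem (hμ.ae_mem hs (by omega) h0.le)
        (by rw [rootPoly_natDegree]; omega) fun x hx => rootPoly_eval_eq_zero_iff.2 (hst hx)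

/-! ### The case `n = 1` and the conclusion -/

/-- Lets (a) follow from the step used for (c), started at the empty vector. Since `0 - 1 = 0`, both
families are `𝒫_0 = {1}`. -/
theorem iRealizable_of_isEmpty (m : Fin 0 → ℝ) : IRealizable m := by
  refine ⟨⟨Measure.dirac 0, inferInstance, fun k => k.elim0⟩, fun P hP => ?_⟩
  have hP : P ∈ monicNonneg 0 := by rcases hP with h | h <;> exact h
  rw [hP.1.natDegree_eq_zero.1 hP.2.1, momentForm_eq, momentFunctional_one]
  norm_num

theorem isMinimizing_X (m : Fin 1 → ℝ) : IsMinimizing X m := by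
  have hX : rootPoly (Finset.range 1) = X := by simp [rootPoly, Lagrange.nodal]
  have hmem : (X : ℝ[X]) ∈ monicNonneg 1 := hX ▸ rootPoly_mem_monicNonneg (isNonnegSet_range 1)
  refine ⟨hmem, fun Q hQ => ?_⟩
  obtain ⟨s, hs, hnn, rfl⟩ := mem_monicNonneg_iff.1 hQ
  obtain ⟨a, rfl⟩ := Finset.card_eq_one.1 hs
  -- Nonnegativity of `X - a` at 0 forces `a = 0`, so `𝒫_1 = {X}`.
  have h0 : (a : ℝ) ≤ 0 := by simpa [rootPoly_eval] using hnn 0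
  have ha : a = 0 := by exact_mod_cast le_antisymm h0 a.cast_nonneg
  subst ha
  exact (congrArg (fun P => momentForm P m) hX.symm).le

theorem momentForm_X (m : Fin 1 → ℝ) : momentForm X m = m 0 := by
  rw [momentForm_eq, ← momentFunctional_X_pow m 0]
  simp

theorem mainTheorem2 (n : ℕ) (hn : 1 ≤ n) (m : Fin n → ℝ) :
    -- every realizable vector is exactly one of I-realizable and B-realizable
    (Realizable m → (IRealizable m ∨ BRealizable m) ∧ ¬ (IRealizable m ∧ BRealizable m)) ∧
    -- (a)
    (n = 1 →
      (0 < m ⟨0, hn⟩ → IRealizable m) ∧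
      (m ⟨0, hn⟩ = 0 → BRealizable m) ∧
      (m ⟨0, hn⟩ < 0 → ¬ Realizable m)) ∧
    -- (b)
    (2 ≤ n → ¬ Realizable (dropLast m) → ¬ Realizable m) ∧
    -- (c)
    (2 ≤ n → IRealizable (dropLast m) →
      (∃ P : Polynomial ℝ, IsMinimizing P m) ∧
      ∀ P : Polynomial ℝ, IsMinimizing P m →
        (Realizable m ↔ 0 ≤ momentForm P m) ∧
        (0 < momentForm P m → IRealizable m) ∧
        (momentForm P m = 0 → BRealizable m)) ∧
    -- (d)
    (2 ≤ n → BRealizable (dropLast m) →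
      (∃ i : ℕ, (i = 1 ∨ i = 2) ∧ ∃ P ∈ monicNonneg (n - i), momentForm P m = 0) ∧
      ∀ i : ℕ, (i = 1 ∨ i = 2) → ∀ P ∈ monicNonneg (n - i), momentForm P m = 0 →
        (Realizable m ↔ momentForm (Polynomial.X ^ i * P) m = 0) ∧
        (BRealizable m ↔ momentForm (Polynomial.X ^ i * P) m = 0)) := by
  obtain ⟨n, rfl⟩ : ∃ k, n = k + 1 := ⟨n - 1, by omega⟩
  refine ⟨fun h => ⟨h.iRealizable_or_bRealizable, not_iRealizable_and_bRealizable⟩, ?_,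
    fun _ h hr => h hr.dropLast,
    fun _ h => ⟨exists_isMinimizing h.1, fun P hP => trichotomy_of_isMinimizing h hP⟩,
    fun h2 h => ⟨?_, ?_⟩⟩
  · intro h
    obtain rfl : n = 0 := by omega
    have key := trichotomy_of_isMinimizing (iRealizable_of_isEmpty _) (isMinimizing_X m)
    rw [momentForm_X] at key
    exact ⟨key.2.1, key.2.2, fun hneg hr => hneg.not_ge (key.1.1 hr)⟩
  · obtain ⟨_, P, hP | hP, h0⟩ := h
    · exact ⟨1, Or.inl rfl, P, hP, by rwa [momentForm_dropLast hP (Nat.le_refl n)] at h0⟩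
    · exact ⟨2, Or.inr rfl, P, hP, by rwa [momentForm_dropLast hP (Nat.sub_le n 1)] at h0⟩
  · intro i hi P hP h0
    obtain ⟨s, hc, hs, rfl⟩ := mem_monicNonneg_iff.1 hP
    have hn' : i + s.card = n + 1 := by omega
    have hback := realizable_of_momentForm_X_pow_mul_eq_zero h.1 hs hn' (by omega) h0
    exact ⟨⟨fun hr => hr.momentForm_X_pow_mul_eq_zero hs hn' h0, hback⟩,
      ⟨fun hb => hb.1.momentForm_X_pow_mul_eq_zero hs hn' h0,
        fun hX => (hback hX).bRealizable_of_eq_zero hs hn' hi h0⟩⟩
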